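/- **Theorem (Hagemann–Herrmann).** Let $\mathcal V$ be a congruence modular variety, i.e. the class of all algebras of a fixed (finitary) signature that satisfy a fixed set of identities, such that the congruence lattice $\mathrm{Con}(A)$ is modular for every $A\in\mathcal V$. For $\alpha,\beta,\delta\in\mathrm{Con}(A)$ let $M(\alpha,\beta)$ be the subalgebra of $A^4$ generated by all $2\times 2$ matrices $$\begin{pmatrix}a&a\\a'&a'\end{pmatrix}\ (a\,\alpha\,a'),\qquad \begin{pmatrix}b&b'\\b&b'\end{pmatrix}\ (b\,\beta\,b').$$ Say that $\alpha$ centralizes $\beta$ modulo $\delta$ if for every $\begin{pmatrix}x&y\\u&z\end{pmatrix}\in M(\alpha,\beta)$, $x\,\delta\,y$ implies $u\,\delta\,z$. The commutator $[\alpha,\beta]$ is the intersection of all $\delta\in\mathrm{Con}(A)$ such that $\alpha$ centralizes $\beta$ modulo $\delta$. For a homomorphism $f:A\to B$ and $\theta\in\mathrm{Con}(A)$, let $f(\theta)$ be the congruence of $B$ generated by $\{(f(x),f(y)):(x,y)\in\theta\}$. Consider operations $C$ that assign to every $A\in\mathcal V$ a binary operation $C$ on $\mathrm{Con}(A)$,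 and the following two properties: (i) $C(\alpha,\beta)\le\alpha\wedge\beta$ for all $A\in\mathcal V$ and $\alpha,\beta\in\mathrm{Con}(A)$; (ii) $f(C(\alpha,\beta))=C(f(\alpha),f(\beta))$ for every surjective homomorphism $f:A\to B$ with $A,B\in\mathcal V$ and all $\alpha,\beta\in\mathrm{Con}(A)$. Then the commutator $(\alpha,\beta)\mapsto[\alpha,\beta]$ has properties (i) and (ii), and it is the greatest such operation: if $C$ has properties (i) and (ii), then $C(\alpha,\beta)\le[\alpha,\beta]$ for all $A\in\mathcal V$ and $\alpha,\beta\in\mathrm{Con}(A)$. -/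

import Mathlib

universe u v w

namespace UniversalAlgebra

/-- A congruence of the `L`-algebra `A`: an equivalence relation on `A` that is compatible with
all fundamental operations. -/
structure Congruence (L : FirstOrder.Language.{u, v}) (A : Type w) [L.Structure A] extends Setoid A where
  compat' : ∀ {n : ℕ} (f : L.Functions n) (x y : Fin n → A),
    (∀ i, toSetoid (x i) (y i)) →
      toSetoid (FirstOrder.Language.Structure.funMap f x) (FirstOrder.Language.Structure.funMap f y)

namespace Congruence

variable {L : FirstOrder.Language.{u, v}} {A : Type w} [L.Structure A]

/-- `θ a b` means that the pair `(a, b)` belongs to the congruence `θ`. -/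
instance : CoeFun (Congruence L A) (fun _ => A → A → Prop) :=
  ⟨fun θ => θ.toSetoid.r⟩

@[ext]
theorem ext {θ ψ : Congruence L A} (h : ∀ a b, θ a b ↔ ψ a b) : θ = ψ := by
  cases θ
  cases ψ
  congr 1
  exact Setoid.ext h

theorem refl (θ : Congruence L A) (a : A) : θ a a := θ.toSetoid.refl a

theorem symm (θ : Congruence L A) {a b : A} (h : θ a b) : θ b a := θ.toSetoid.symm h

theorem trans (θ : Congruence L A) {a b c : A} (h : θ a b) (h' : θ b c) : θ a c :=
  θ.toSetoid.trans h h'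

theorem compat (θ : Congruence L A) {n : ℕ} (f : L.Functions n) {x y : Fin n → A}
    (h : ∀ i, θ (x i) (y i)) :
    θ (FirstOrder.Language.Structure.funMap f x) (FirstOrder.Language.Structure.funMap f y) :=
  θ.compat' f x y h

/-- Congruences are ordered by inclusion. -/
instance : PartialOrder (Congruence L A) where
  le θ ψ := ∀ ⦃a b : A⦄, θ a b → ψ a b
  le_refl _ _ _ h := h
  le_trans _ _ _ h h' _ _ k := h' (h k)
  le_antisymm _ _ h h' := Congruence.ext fun _ _ => ⟨fun k => h k, fun k => h' k⟩

/-- The intersection of a set of congruences. -/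
instance : InfSet (Congruence L A) where
  sInf S :=
    { r := fun a b => ∀ θ ∈ S, θ a b
      iseqv :=
        { refl := fun a θ _ => θ.refl a
          symm := fun h θ hθ => θ.symm (h θ hθ)
          trans := fun h h' θ hθ => θ.trans (h θ hθ) (h' θ hθ) }
      compat' := fun f _ _ h θ hθ => θ.compat f fun i => h i θ hθ }

/-- The congruence lattice `Con(A)`: meets are intersections, and the join of a set of
congruences is the least congruence containing all of them. -/
instance : CompleteLattice (Congruence L A) where
  __ := completeLatticeOfInf (Congruence L A) fun _ =>
    ⟨fun _ hθ _ _ h => h _ hθ, fun _ hψ _ _ h _ hθ => hψ hθ h⟩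
  inf θ ψ :=
    { r := fun a b => θ a b ∧ ψ a b
      iseqv :=
        { refl := fun a => ⟨θ.refl a, ψ.refl a⟩
          symm := fun h => ⟨θ.symm h.1, ψ.symm h.2⟩
          trans := fun h h' => ⟨θ.trans h.1 h'.1, ψ.trans h.2 h'.2⟩ }
      compat' := fun f _ _ h => ⟨θ.compat f fun i => (h i).1, ψ.compat f fun i => (h i).2⟩ }
  inf_le_left _ _ _ _ h := h.1
  inf_le_right _ _ _ _ h := h.2
  le_inf _ _ _ h h' _ _ k := ⟨h k, h' k⟩

/-- The congruence `Cg(X)` generated by a set `X` of pairs. -/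
def generate (X : Set (A × A)) : Congruence L A :=
  sInf {θ | ∀ p ∈ X, θ p.1 p.2}

/-- The image `f(θ)`: the congruence of `B` generated by all pairs `(f a, f b)` with
`(a, b) ∈ θ`. -/
def map {B : Type w} [L.Structure B] (f : L.Hom A B) (θ : Congruence L A) : Congruence L B :=
  generate {p | ∃ a b, θ a b ∧ p = (f a, f b)}

/-- The power algebra `A⁴`, written as the algebra of `2 × 2` matrices with entries in `A`, with
entrywise operations. -/
instance matrixStructure : L.Structure (Matrix (Fin 2) (Fin 2) A) where
  funMap f x := Matrix.of fun i j => FirstOrder.Language.Structure.funMap f fun k => x k i j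
  RelMap r x := ∀ i j, FirstOrder.Language.Structure.RelMap r fun k => x k i j

/-- `M(α, β)`: the subalgebra of `A⁴` generated by the matrices with rows `(a, a)`, `(a', a')`
where `a α a'`, and the matrices with both rows equal to `(b, b')` where `b β b'`. -/
def matrices (α β : Congruence L A) : L.Substructure (Matrix (Fin 2) (Fin 2) A) :=
  FirstOrder.Language.Substructure.closure L
    ({m | ∃ a a', α a a' ∧ m = !![a, a; a', a']} ∪ {m | ∃ b b', β b b' ∧ m = !![b, b'; b, b']})

/-- `C(α, β; δ)`: `α` centralizes `β` modulo `δ`. -/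
def Centralizes (α β δ : Congruence L A) : Prop :=
  ∀ m ∈ matrices α β, δ (m 0 0) (m 0 1) → δ (m 1 0) (m 1 1)

/-- The commutator `[α, β]`: the intersection (hence the least) of all congruences `δ` such that
`α` centralizes `β` modulo `δ`. -/
def commutator (α β : Congruence L A) : Congruence L A :=
  sInf {δ | Centralizes α β δ}

end Congruence

variable {L : FirstOrder.Language.{u, v}}

/-- `A` satisfies all identities `s ≈ t` with `(s, t) ∈ E`, that is, `A` belongs to the variety
defined by the set `E` of identities. -/
def InVariety (E : Set (L.Term ℕ × L.Term ℕ)) (A : Type w) [L.Structure A] : Prop :=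
  ∀ e ∈ E, ∀ x : ℕ → A, e.1.realize x = e.2.realize x

/-- The variety defined by `E` is congruence modular: all its members have modular congruence
lattices. -/
def IsCongruenceModular (E : Set (L.Term ℕ × L.Term ℕ)) : Prop :=
  ∀ (A : Type w) [L.Structure A], InVariety E A → IsModularLattice (Congruence L A)

/-- Binary operations defined on the congruence lattices of all members of the variety defined
by `E`. -/
abbrev CongruenceOperation (E : Set (L.Term ℕ × L.Term ℕ)) : Type (max u v (w + 1)) :=
  ∀ (A : Type w) [L.Structure A], InVariety E A →
    Congruence L A → Congruence L A → Congruence L A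

/-- The two Hagemann–Herrmann properties of a binary operation on congruence lattices. -/
structure IsHagemannHerrmann {E : Set (L.Term ℕ × L.Term ℕ)}
    (C : CongruenceOperation.{u, v, w} E) : Prop where
  le_inf : ∀ (A : Type w) [L.Structure A] (hA : InVariety E A) (α β : Congruence L A),
    C A hA α β ≤ α ⊓ β
  map_eq : ∀ (A B : Type w) [L.Structure A] [L.Structure B]
    (hA : InVariety E A) (hB : InVariety E B) (f : L.Hom A B), Function.Surjective f →
    ∀ α β : Congruence L A, (C A hA α β).map f = C B hB (α.map f) (β.map f)

/-- The commutator, as a binary operation on the congruence lattices of all members of the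
variety defined by `E`. -/
def commutatorOperation (E : Set (L.Term ℕ × L.Term ℕ)) : CongruenceOperation.{u, v, w} E :=
  fun _ _ _ α β => α.commutator β

end UniversalAlgebra

/-! The engine is Day's argument: in a modular variety, a term condition on columns modulo δ implies
the one on rows modulo every γ ≥ δ, even for matrices pasted side by side (`rel_of_chain`).
Transposing, centralization also controls columns and passes to larger congruences
(`Centralizes.cols`).

For (ii), f(α) and f(β) are transitive closures of direct images, so each matrix of M(f(α), f(β)) is
a grid pasted from images of matrices of M(α, β). The term condition survives pasting, so f(α)
centralizes f(β) modulo f([α, β]).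

For maximality, regard α as a subalgebra of A², let η be the kernel of the first projection and let
Δ be the congruence obtained from M(α, β) as a relation between columns. The second projection sends
η to α and Δ to β, so C(α, β) is the image of C(η, Δ) ≤ η ∧ Δ. A pair in η ∧ Δ is a pasted matrix
with equal top entries, so its bottom entries are δ-related for every centralizing δ. -/

namespace UniversalAlgebra

open FirstOrder FirstOrder.Language FirstOrder.Language.Structure Relation

/-! ### Chains of a compatible relation -/

section Chains

/-- An operation that preserves `R` when one argument is moved, the others staying in the domain
`P`, preserves `R`-chains in all arguments. -/
theorem reflTransGen_op {X : Type*} {n : ℕ} {R : X → X → Prop} {P : X → Prop}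
    {op : (Fin n → X) → X} (hP : ∀ a b, R a b → P b)
    (hR : ∀ (g : Fin n → X) (j : Fin n) (a b : X), (∀ k, P (g k)) → R a b →
      R (op (Function.update g j a)) (op (Function.update g j b)))
    {x y : Fin n → X} (hx : ∀ i, P (x i)) (h : ∀ i, ReflTransGen R (x i) (y i)) :
    ReflTransGen R (op x) (op y) := by
  classical
  have hy : ∀ i, P (y i) := fun i => by
    rcases (h i).cases_tail with e | ⟨c, -, hc⟩
    · exact e ▸ hx i
    · exact hP _ _ hc
  -- Coordinates move one at a time; the intermediate tuples mix entries of `x` and `y`, so both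
  -- must lie in `P`.
  have key : ∀ s : Finset (Fin n), ReflTransGen R (op x) (op (s.piecewise y x)) := by
    intro s
    induction s using Finset.induction_on with
    | empty => simpa using ReflTransGen.refl
    | insert j s hj ih =>
      refine ih.trans ?_
      rw [Finset.piecewise_insert]
      have hg : ∀ k, P (s.piecewise y x k) := fun k => by
        by_cases hk : k ∈ s
        · simpa [hk] using hy k
        · simpa [hk] using hx k
      have := ReflTransGen.lift (p := R) (fun a => op (Function.update (s.piecewise y x) j a))
        (fun a b hab => hR _ j a b hg hab) _ _ (h j)
      rwa [Function.onFun, ← Finset.piecewise_eq_of_notMem s y x hj, Function.update_eq_self] at this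
  simpa using key Finset.univ

theorem rel_update {X : Type*} {n : ℕ} {R : X → X → Prop} {g : Fin n → X}
    (hg : ∀ k, R (g k) (g k)) {j : Fin n} {a b : X} (hab : R a b) (k : Fin n) :
    R (Function.update g j a k) (Function.update g j b k) := by
  by_cases hk : k = j
  · subst hk; simpa using hab
  · simpa [hk] using hg k

end Chains

/-! ### Images and preimages of congruences -/

namespace Congruence

variable {L : FirstOrder.Language.{u, v}} {A B : Type w} [L.Structure A] [L.Structure B]

/-- The reflexive transitive closure of a symmetric relation that is preserved by all unary
translations. -/
def ofChains (R : A → A → Prop) (symm : ∀ a b, R a b → R b a)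
    (compat : ∀ {n : ℕ} (f : L.Functions n) (g : Fin n → A) (j : Fin n) (a b : A), R a b →
      R (funMap f (Function.update g j a)) (funMap f (Function.update g j b))) :
    Congruence L A where
  r := ReflTransGen R
  iseqv :=
    { refl := fun _ => ReflTransGen.refl
      symm := fun h => have : Std.Symm R := ⟨symm⟩; Std.Symm.symm _ _ h
      trans := fun h h' => h.trans h' }
  compat' f _ _ h := reflTransGen_op (P := fun _ => True) (fun _ _ _ => trivial)
    (fun g j a b _ hab => compat f g j a b hab) (fun _ => trivial) h

/-- The preimage of a congruence under a homomorphism. -/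
def comap (f : L.Hom A B) (θ : Congruence L B) : Congruence L A where
  r a b := θ (f a) (f b)
  iseqv :=
    { refl := fun _ => θ.refl _
      symm := fun h => θ.symm h
      trans := fun h h' => θ.trans h h' }
  compat' g x y h := by
    rw [f.map_fun, f.map_fun]
    exact θ.compat g h

theorem map_le_iff {f : L.Hom A B} {θ : Congruence L A} {ψ : Congruence L B} :
    θ.map f ≤ ψ ↔ ∀ a b, θ a b → ψ (f a) (f b) := by
  constructor
  · intro h a b hab
    exact h fun χ hχ => hχ (f a, f b) ⟨a, b, hab, rfl⟩
  · intro h a b hab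
    refine hab ψ ?_
    rintro _ ⟨a, b, hab, rfl⟩
    exact h a b hab

theorem map_apply (f : L.Hom A B) {θ : Congruence L A} {a b : A} (h : θ a b) :
    θ.map f (f a) (f b) :=
  map_le_iff.1 le_rfl a b h

/-- For surjective `f`, the image `f(θ)` is the transitive closure of the direct image of `θ`. -/
theorem reflTransGen_of_map {f : L.Hom A B} (hf : Function.Surjective f) {θ : Congruence L A}
    {a b : B} (h : θ.map f a b) :
    ReflTransGen (fun c d => ∃ c' d', θ c' d' ∧ f c' = c ∧ f d' = d) a b := by
  refine map_le_iff (ψ := ofChains _ ?_ ?_) |>.2 ?_ h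
  · rintro _ _ ⟨c, d, hcd, rfl, rfl⟩
    exact ⟨d, c, θ.symm hcd, rfl, rfl⟩
  · intro n g x j c d hcd
    -- Surjectivity makes the direct image reflexive, as the unmoved arguments require.
    have hx : ∀ k, ∃ c' d', θ c' d' ∧ f c' = x k ∧ f d' = x k := fun k =>
      let ⟨e, he⟩ := hf (x k)
      ⟨e, e, θ.refl e, he, he⟩
    choose p q hpq hp hq using rel_update (R := fun c d => ∃ c' d', θ c' d' ∧ f c' = c ∧ f d' = d)
      hx (j := j) hcd
    refine ⟨funMap g p, funMap g q, θ.compat g hpq, ?_, ?_⟩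
    · rw [f.map_fun]; exact congrArg _ (funext hp)
    · rw [f.map_fun]; exact congrArg _ (funext hq)
  · exact fun a b hab => ReflTransGen.single ⟨a, b, hab, rfl, rfl⟩

theorem realize {θ : Congruence L A} {ι : Type*} (t : L.Term ι) {x y : ι → A}
    (h : ∀ i, θ (x i) (y i)) : θ (t.realize x) (t.realize y) := by
  induction t with
  | var i => exact h i
  | func f ts ih => exact θ.compat f ih

end Congruence

variable {L : FirstOrder.Language.{u, v}} {A B : Type w} [L.Structure A] [L.Structure B]

theorem InVariety.of_jointly_injective {E : Set (L.Term ℕ × L.Term ℕ)} (hA : InVariety E A)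
    {ι : Type*} (f : ι → L.Hom B A) (hf : ∀ x y : B, (∀ i, f i x = f i y) → x = y) :
    InVariety E B := fun e he x => hf _ _ fun i => by
  rw [← HomClass.realize_term, ← HomClass.realize_term]
  exact hA e he _

/-! ### Day terms from modularity -/

section Day

/-- The `k`-ary term operations of `A`: the free `k`-generated algebra in the variety generated
by `A`. -/
def TermOperation (L : FirstOrder.Language.{u, v}) (A : Type w) [L.Structure A] (k : ℕ) : Type w :=
  {g : (Fin k → A) → A // ∃ t : L.Term (Fin k), ∀ v, t.realize v = g v}

namespace TermOperation

variable {k : ℕ}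

instance [L.IsAlgebraic] : L.Structure (TermOperation L A k) where
  funMap f x := ⟨fun v => funMap f fun i => (x i).1 v, by
    choose t ht using fun i => (x i).2
    exact ⟨Term.func f t, fun v => congrArg (funMap f) (funext fun i => ht i v)⟩⟩
  RelMap r _ := isEmptyElim r

variable [L.IsAlgebraic]

/-- Evaluation at a tuple. -/
def eval (v : Fin k → A) : L.Hom (TermOperation L A k) A where
  toFun g := g.1 v
  map_fun' _ _ := rfl
  map_rel' r _ := isEmptyElim r

/-- The projections. -/
def proj (i : Fin k) : TermOperation L A k := ⟨fun v => v i, Term.var i, fun _ => rfl⟩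

/-- Two operations are identified when they agree on all tuples of the form `s x`. -/
def kernel {ι : Type*} (s : ι → Fin k → A) : Congruence L (TermOperation L A k) where
  r g h := ∀ x, g.1 (s x) = h.1 (s x)
  iseqv :=
    { refl := fun _ _ => rfl
      symm := fun h x => (h x).symm
      trans := fun h h' x => (h x).trans (h' x) }
  compat' f _ _ h x := congrArg (funMap f) (funext fun i => h i x)

end TermOperation

open TermOperation in
/-- Day's characterization of congruence modularity, in the form of Gumm's shifting argument. -/
theorem rel_of_day [L.IsAlgebraic] {E : Set (L.Term ℕ × L.Term ℕ)}
    (hE : IsCongruenceModular.{u, v, w} E) (hA : InVariety E A) (γ : Congruence L A) {a b c d : A}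
    (hbd : γ b d)
    (H : ∀ t : L.Term (Fin 4), (∀ x y : A, t.realize ![x, y, y, x] = x) →
      γ (t.realize ![a, a, c, c]) (t.realize ![a, b, d, c])) : γ a c := by
  -- Term operations, unlike terms, stay in the universe of `A`, where modularity is assumed.
  have : IsModularLattice (Congruence L (TermOperation L A 4)) :=
    hE _ (hA.of_jointly_injective eval fun x y h => Subtype.ext (funext h))
  let θα : Congruence L (TermOperation L A 4) :=
    kernel fun p : A × A => ![p.1, p.1, p.2, p.2]
  let θβ : Congruence L (TermOperation L A 4) :=
    kernel fun p : A × A => ![p.1, p.2, p.2, p.1]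
  let θγ : Congruence L (TermOperation L A 4) :=
    kernel fun p : A × A × A => ![p.1, p.2.1, p.2.1, p.2.2]
  have hγβ : θγ ≤ θβ := fun g h hgh p => hgh (p.1, p.2, p.1)
  have h1 : (θγ ⊔ θα) (proj 0) (proj 3) := by
    have e1 : θα (proj 0) (proj 1) := fun _ => rfl
    have e2 : θγ (proj 1) (proj 2) := fun _ => rfl
    have e3 : θα (proj 2) (proj 3) := fun _ => rfl
    have hα : θα ≤ θγ ⊔ θα := le_sup_right
    have hγ : θγ ≤ θγ ⊔ θα := le_sup_left
    exact Congruence.trans _ (hα e1) (Congruence.trans _ (hγ e2) (hα e3))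
  -- The modular law; a chain witnessing this membership is a sequence of Day terms.
  have h2 : (θγ ⊔ θα ⊓ θβ) (proj 0) (proj 3) :=
    (IsModularLattice.sup_inf_le_assoc_of_le θα hγβ) ⟨h1, fun _ => rfl⟩
  let R : TermOperation L A 4 → TermOperation L A 4 → Prop :=
    fun g h => θγ g h ∨ (θα ⊓ θβ) g h
  have h3 : θγ ⊔ θα ⊓ θβ ≤ Congruence.ofChains R
      (fun g h => Or.imp (Congruence.symm _) (Congruence.symm _))
      (fun f g j p q => Or.imp
        (fun h => Congruence.compat _ f (rel_update (fun k => Congruence.refl _ (g k)) h))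
        (fun h => Congruence.compat _ f (rel_update (fun k => Congruence.refl _ (g k)) h))) :=
    sup_le (fun _ _ h => ReflTransGen.single (Or.inl h))
      (fun _ _ h => ReflTransGen.single (Or.inr h))
  have h4 : ReflTransGen R (proj 0) (proj 3) := h3 h2
  -- At `proj 3` the second invariant reads `γ a c`.
  have key : ∀ g, ReflTransGen R (proj 0) g →
      (∀ x y : A, g.1 ![x, y, y, x] = x) ∧ γ a (g.1 ![a, b, d, c]) := by
    intro g hg
    induction hg with
    | refl => exact ⟨fun _ _ => rfl, γ.refl a⟩
    | @tail g h _ hgh ih =>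
      have hβ : θβ g h := hgh.elim (fun k => hγβ k) fun k => k.2
      have ih' : ∀ x y : A, h.1 ![x, y, y, x] = x := fun x y =>
        (hβ (x, y)).symm.trans (ih.1 x y)
      refine ⟨ih', γ.trans ih.2 ?_⟩
      rcases hgh with hgh | hgh
      · have shift : ∀ k : TermOperation L A 4,
            γ (k.1 ![a, b, d, c]) (k.1 ![a, b, b, c]) := by
          rintro ⟨k, t, ht⟩
          simp only [← ht]
          refine Congruence.realize t fun i => ?_
          fin_cases i
          exacts [γ.refl _, γ.refl _, γ.symm hbd, γ.refl _]
        have e : g.1 ![a, b, b, c] = h.1 ![a, b, b, c] := hgh (a, b, c)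
        exact γ.trans (shift g) (e ▸ γ.symm (shift h))
      · have shift : ∀ k : TermOperation L A 4, (∀ x y : A, k.1 ![x, y, y, x] = x) →
            γ (k.1 ![a, a, c, c]) (k.1 ![a, b, d, c]) := by
          rintro ⟨k, t, ht⟩ hk
          simp only [← ht] at hk ⊢
          exact H t hk
        have e : g.1 ![a, a, c, c] = h.1 ![a, a, c, c] := hgh.1 (a, c)
        exact γ.trans (γ.symm (shift g ih.1)) (e ▸ shift h ih')
  exact (key _ h4).2

end Day

/-! ### Term conditions for square relations and pasted matrices -/

section SquareRelation

/-- A compatible relation between `2 × 2` matrices with rows `(x, y)` and `(p, q)` that is closed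
under repeating and swapping rows and columns. -/
structure IsSquareRelation (L : FirstOrder.Language.{u, v}) {A : Type w} [L.Structure A]
    (N : A → A → A → A → Prop) : Prop where
  compat : ∀ {n : ℕ} (f : L.Functions n) {x y p q : Fin n → A},
    (∀ i, N (x i) (y i) (p i) (q i)) → N (funMap f x) (funMap f y) (funMap f p) (funMap f q)
  rows : ∀ {x y p q}, N x y p q → N x y x y
  cols : ∀ {x y p q}, N x y p q → N x x p p
  swap_rows : ∀ {x y p q}, N x y p q → N p q x y
  swap_cols : ∀ {x y p q}, N x y p q → N y x q p

namespace IsSquareRelation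

variable {N : A → A → A → A → Prop}

theorem transpose (hN : IsSquareRelation L N) : IsSquareRelation L fun x y p q => N x p y q where
  compat f _ _ _ _ h := hN.compat f h
  rows := hN.cols
  cols := hN.rows
  swap_rows := hN.swap_cols
  swap_cols := hN.swap_rows

theorem realize (hN : IsSquareRelation L N) {ι : Type*} (t : L.Term ι) {x y p q : ι → A}
    (h : ∀ i, N (x i) (y i) (p i) (q i)) :
    N (t.realize x) (t.realize y) (t.realize p) (t.realize q) := by
  induction t with
  | var i => exact h i
  | func f ts ih => exact hN.compat f ih

/-- In a congruence modular variety, if the square relation `N` satisfies the term condition for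
columns modulo `δ`, then horizontal chains of `N` satisfy it for rows modulo every `γ ≥ δ`. -/
theorem rel_of_chain [L.IsAlgebraic] {E : Set (L.Term ℕ × L.Term ℕ)}
    (hE : IsCongruenceModular.{u, v, w} E) (hA : InVariety E A) (hN : IsSquareRelation L N)
    {δ γ : Congruence L A} (hδ : ∀ x y p q, N x y p q → δ x p → δ y q) (hδγ : δ ≤ γ)
    {x y p q : A} (h : ReflTransGen (fun c d : A × A => N c.1 d.1 c.2 d.2) (x, p) (y, q))
    (hxy : γ x y) : γ p q := by
  -- An empty chain supplies no matrix, but then `p = q`.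
  rcases h.cases_head with e | ⟨⟨x', p'⟩, h0, -⟩
  · obtain ⟨-, rfl⟩ := Prod.mk.inj e
    exact γ.refl _
  have hx : N p p x x := hN.swap_rows (hN.cols h0)
  have hp : N p p p p := hN.rows hx
  refine rel_of_day hE hA γ hxy fun t ht => hδγ ?_
  have key : ∀ c : A × A, ReflTransGen (fun c d : A × A => N c.1 d.1 c.2 d.2) (x, p) c →
      δ (t.realize ![p, p, c.2, c.2]) (t.realize ![p, x, c.1, c.2]) := by
    intro c hc
    induction hc with
    | refl => simp only [ht]; exact δ.refl p
    | @tail c d _ hcd ih =>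
      -- Applying `t` to four matrices of `N` gives a matrix whose columns are the old and the new
      -- instance of the claim.
      refine hδ _ _ _ _ (hN.realize t fun i => ?_) ih
      have hcd' := hN.swap_rows hcd
      fin_cases i
      exacts [hp, hx, hcd', hN.rows hcd']
  exact key _ h

/-- In a congruence modular variety, the term condition for columns modulo `δ` implies the term
condition for rows modulo every `γ ≥ δ`. -/
theorem rel_of_rel [L.IsAlgebraic] {E : Set (L.Term ℕ × L.Term ℕ)}
    (hE : IsCongruenceModular.{u, v, w} E) (hA : InVariety E A) (hN : IsSquareRelation L N)
    {δ γ : Congruence L A} (hδ : ∀ x y p q, N x y p q → δ x p → δ y q) (hδγ : δ ≤ γ)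
    {x y p q : A} (h : N x y p q) (hxy : γ x y) : γ p q :=
  hN.rel_of_chain hE hA hδ hδγ (.single h) hxy

/-- Horizontal chains of `N`. -/
def horizontal (N : A → A → A → A → Prop) (x y p q : A) : Prop :=
  -- The first conjunct matters only for empty chains: it puts the start in the domain where `N` is
  -- reflexive.
  N x x p p ∧ ReflTransGen (fun c d : A × A => N c.1 d.1 c.2 d.2) (x, p) (y, q)

theorem horizontal_compat (hN : IsSquareRelation L N) {n : ℕ} (f : L.Functions n)
    {x y p q : Fin n → A} (h : ∀ i, horizontal N (x i) (y i) (p i) (q i)) :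
    horizontal N (funMap f x) (funMap f y) (funMap f p) (funMap f q) := by
  refine ⟨hN.compat f fun i => (h i).1, ?_⟩
  refine reflTransGen_op (R := fun c d : A × A => N c.1 d.1 c.2 d.2)
    (P := fun c => N c.1 c.1 c.2 c.2)
    (op := fun c => (funMap f fun i => (c i).1, funMap f fun i => (c i).2))
    (x := fun i => (x i, p i)) (y := fun i => (y i, q i))
    (fun a b hab => hN.cols (hN.swap_cols hab)) ?_ (fun i => (h i).1) (fun i => (h i).2)
  intro g j a b hg hab
  exact hN.compat f fun i =>
    rel_update (R := fun c d : A × A => N c.1 d.1 c.2 d.2) hg (j := j) hab i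

theorem horizontal_rows (hN : IsSquareRelation L N) {x y p q : A} (h : horizontal N x y p q) :
    horizontal N x y x y :=
  ⟨hN.rows h.1, ReflTransGen.lift (p := fun c d : A × A => N c.1 d.1 c.2 d.2)
    (fun c : A × A => (c.1, c.1)) (fun _ _ hcd => hN.rows hcd) _ _ h.2⟩

theorem horizontal_swap_rows (hN : IsSquareRelation L N) {x y p q : A}
    (h : horizontal N x y p q) : horizontal N p q x y :=
  ⟨hN.swap_rows h.1, ReflTransGen.lift (p := fun c d : A × A => N c.1 d.1 c.2 d.2)
    (fun c : A × A => (c.2, c.1)) (fun _ _ hcd => hN.swap_rows hcd) _ _ h.2⟩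

/-- Vertical chains of horizontal chains of `N`. -/
def grid (N : A → A → A → A → Prop) (x y p q : A) : Prop :=
  horizontal N x y x y ∧
    ReflTransGen (fun c d : A × A => horizontal N c.1 c.2 d.1 d.2) (x, y) (p, q)

theorem grid_compat (hN : IsSquareRelation L N) {n : ℕ} (f : L.Functions n)
    {x y p q : Fin n → A} (h : ∀ i, grid N (x i) (y i) (p i) (q i)) :
    grid N (funMap f x) (funMap f y) (funMap f p) (funMap f q) := by
  refine ⟨hN.horizontal_compat f fun i => (h i).1, ?_⟩
  refine reflTransGen_op (R := fun c d : A × A => horizontal N c.1 c.2 d.1 d.2)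
    (P := fun c => horizontal N c.1 c.2 c.1 c.2)
    (op := fun c => (funMap f fun i => (c i).1, funMap f fun i => (c i).2))
    (x := fun i => (x i, y i)) (y := fun i => (p i, q i))
    (fun a b hab => hN.horizontal_rows (hN.horizontal_swap_rows hab)) ?_
    (fun i => (h i).1) (fun i => (h i).2)
  intro g j a b hg hab
  exact hN.horizontal_compat f fun i =>
    rel_update (R := fun c d : A × A => horizontal N c.1 c.2 d.1 d.2) hg (j := j) hab i

end IsSquareRelation

end SquareRelation

/-! ### M(α, β) and properties (i) and (ii) of the commutator -/

namespace Congruence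

/-- Membership in `M(α, β)` as a relation between four elements. -/
def square (α β : Congruence L A) (x y p q : A) : Prop :=
  !![x, y; p, q] ∈ matrices α β

theorem mem_matrices_iff {α β : Congruence L A} {m : Matrix (Fin 2) (Fin 2) A} :
    m ∈ matrices α β ↔ square α β (m 0 0) (m 0 1) (m 1 0) (m 1 1) := by
  rw [square, ← Matrix.eta_fin_two m]

theorem square_left {α β : Congruence L A} {a b : A} (h : α a b) : square α β a a b b :=
  Substructure.subset_closure (Or.inl ⟨a, b, h, rfl⟩)

theorem square_right {α β : Congruence L A} {a b : A} (h : β a b) : square α β a b a b :=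
  Substructure.subset_closure (Or.inr ⟨a, b, h, rfl⟩)

theorem square_compat {α β : Congruence L A} {n : ℕ} (f : L.Functions n) {x y p q : Fin n → A}
    (h : ∀ i, square α β (x i) (y i) (p i) (q i)) :
    square α β (funMap f x) (funMap f y) (funMap f p) (funMap f q) := by
  have := (matrices α β).fun_mem f (fun i => !![x i, y i; p i, q i]) h
  exact mem_matrices_iff.1 this

theorem square_induction {α β : Congruence L A} {Q : A → A → A → A → Prop}
    (left : ∀ a b, α a b → Q a a b b) (right : ∀ a b, β a b → Q a b a b)
    (compat : ∀ {n : ℕ} (f : L.Functions n) (x y p q : Fin n → A),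
      (∀ i, Q (x i) (y i) (p i) (q i)) →
        Q (funMap f x) (funMap f y) (funMap f p) (funMap f q))
    {x y p q : A} (h : square α β x y p q) : Q x y p q := by
  have := Substructure.closure_induction
    (p := fun m : Matrix (Fin 2) (Fin 2) A => Q (m 0 0) (m 0 1) (m 1 0) (m 1 1)) h
    (by
      rintro _ (⟨a, b, hab, rfl⟩ | ⟨a, b, hab, rfl⟩)
      · exact left a b hab
      · exact right a b hab)
    (fun {n} f m hm => compat f _ _ _ _ hm)
  exact this

theorem isSquareRelation_square (α β : Congruence L A) : IsSquareRelation L (square α β) where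
  compat f _ _ _ _ h := square_compat f h
  rows := square_induction (Q := fun x y _ _ => square α β x y x y)
    (fun a _ _ => square_left (α.refl a)) (fun _ _ h => square_right h)
    fun f _ _ _ _ h => square_compat f h
  cols := square_induction (Q := fun x _ p _ => square α β x x p p)
    (fun _ _ h => square_left h) (fun a _ _ => square_right (β.refl a))
    fun f _ _ _ _ h => square_compat f h
  swap_rows := square_induction (Q := fun x y p q => square α β p q x y)
    (fun _ _ h => square_left (α.symm h)) (fun _ _ h => square_right h)
    fun f _ _ _ _ h => square_compat f h
  swap_cols := square_induction (Q := fun x y p q => square α β y x q p)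
    (fun _ _ h => square_left h) (fun _ _ h => square_right (β.symm h))
    fun f _ _ _ _ h => square_compat f h

theorem square_rel {α β : Congruence L A} {x y p q : A} (h : square α β x y p q) :
    (α x p ∧ α y q) ∧ β x y ∧ β p q :=
  square_induction (Q := fun x y p q => (α x p ∧ α y q) ∧ β x y ∧ β p q)
    (fun _ _ h => ⟨⟨h, h⟩, β.refl _, β.refl _⟩) (fun _ _ h => ⟨⟨α.refl _, α.refl _⟩, h, h⟩)
    (fun f _ _ _ _ h => ⟨⟨α.compat f fun i => (h i).1.1, α.compat f fun i => (h i).1.2⟩,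
      β.compat f fun i => (h i).2.1, β.compat f fun i => (h i).2.2⟩) h

theorem centralizes_iff {α β δ : Congruence L A} :
    Centralizes α β δ ↔ ∀ x y p q, square α β x y p q → δ x y → δ p q :=
  ⟨fun h _ _ _ _ hm hxy => h _ hm hxy, fun h _ hm hxy => h _ _ _ _ (mem_matrices_iff.1 hm) hxy⟩

theorem centralizes_commutator (α β : Congruence L A) : Centralizes α β (commutator α β) :=
  fun m hm h δ hδ => hδ m hm (h δ hδ)

/-- `α ⊓ β` itself centralizes: rows lie in β, and the bottom entries are α-linked through the top
row. -/
theorem commutator_le_inf (α β : Congruence L A) : commutator α β ≤ α ⊓ β := by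
  refine fun a b h => h (α ⊓ β) (centralizes_iff.2 fun x y p q hm hxy => ?_)
  have h' := square_rel hm
  exact ⟨α.trans (α.symm h'.1.1) (α.trans hxy.1 h'.1.2), h'.2.2⟩

/-- Since `f` carries M(α, β) into M(f(α), f(β)), preimages of centralizing congruences centralize.
-/
theorem commutator_map_le (f : L.Hom A B) (α β : Congruence L A) :
    (commutator α β).map f ≤ commutator (α.map f) (β.map f) := by
  refine map_le_iff.2 fun a b hab δ hδ => ?_
  refine hab (comap f δ) (centralizes_iff.2 fun x y p q hm hxy => ?_)
  refine centralizes_iff.1 hδ (f x) (f y) (f p) (f q) ?_ hxy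
  refine square_induction
    (Q := fun x y p q => square (α.map f) (β.map f) (f x) (f y) (f p) (f q))
    (fun _ _ h => square_left (map_apply f h)) (fun _ _ h => square_right (map_apply f h))
    (fun g _ _ _ _ h => ?_) hm
  simp only [f.map_fun]
  exact square_compat g h

/-- The direct image of `M(α, β)`. -/
def imageSquare (f : L.Hom A B) (α β : Congruence L A) (x y p q : B) : Prop :=
  ∃ x' y' p' q', square α β x' y' p' q' ∧ f x' = x ∧ f y' = y ∧ f p' = p ∧ f q' = q

theorem isSquareRelation_imageSquare (f : L.Hom A B) (α β : Congruence L A) :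
    IsSquareRelation L (imageSquare f α β) where
  compat g x y p q h := by
    choose x' y' p' q' h hx hy hp hq using h
    refine ⟨_, _, _, _, square_compat g h, ?_, ?_, ?_, ?_⟩ <;> rw [f.map_fun]
    · exact congrArg _ (funext hx)
    · exact congrArg _ (funext hy)
    · exact congrArg _ (funext hp)
    · exact congrArg _ (funext hq)
  rows := by
    rintro _ _ _ _ ⟨x, y, p, q, h, rfl, rfl, rfl, rfl⟩
    exact ⟨_, _, _, _, (isSquareRelation_square α β).rows h, rfl, rfl, rfl, rfl⟩
  cols := by
    rintro _ _ _ _ ⟨x, y, p, q, h, rfl, rfl, rfl, rfl⟩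
    exact ⟨_, _, _, _, (isSquareRelation_square α β).cols h, rfl, rfl, rfl, rfl⟩
  swap_rows := by
    rintro _ _ _ _ ⟨x, y, p, q, h, rfl, rfl, rfl, rfl⟩
    exact ⟨_, _, _, _, (isSquareRelation_square α β).swap_rows h, rfl, rfl, rfl, rfl⟩
  swap_cols := by
    rintro _ _ _ _ ⟨x, y, p, q, h, rfl, rfl, rfl, rfl⟩
    exact ⟨_, _, _, _, (isSquareRelation_square α β).swap_cols h, rfl, rfl, rfl, rfl⟩

/-- Grids are closed under the operations, and chains for f(α) and f(β) turn the generators into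
vertical and horizontal pastings. -/
theorem grid_of_square_map {f : L.Hom A B} (hf : Function.Surjective f) {α β : Congruence L A}
    {x y p q : B} (h : square (α.map f) (β.map f) x y p q) :
    IsSquareRelation.grid (imageSquare f α β) x y p q := by
  have diag : ∀ a : B, imageSquare f α β a a a a := fun a => by
    obtain ⟨a, rfl⟩ := hf a
    exact ⟨a, a, a, a, square_left (α.refl a), rfl, rfl, rfl, rfl⟩
  refine square_induction (fun a b hab => ⟨⟨diag a, .refl⟩, ?_⟩) (fun a b hab => ⟨?_, .refl⟩)
    (fun g _ _ _ _ h => (isSquareRelation_imageSquare f α β).grid_compat g h) h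
  · refine ReflTransGen.lift (fun c => (c, c)) ?_ _ _ (reflTransGen_of_map hf hab)
    rintro _ _ ⟨c, d, hcd, rfl, rfl⟩
    exact ⟨⟨c, c, d, d, square_left hcd, rfl, rfl, rfl, rfl⟩, .refl⟩
  · refine ⟨diag a, ReflTransGen.lift (fun c => (c, c)) ?_ _ _ (reflTransGen_of_map hf hab)⟩
    rintro _ _ ⟨c, d, hcd, rfl, rfl⟩
    exact ⟨c, d, c, d, square_right hcd, rfl, rfl, rfl, rfl⟩

/-- In a congruence modular variety, centralization modulo `δ` passes to columns and to larger
congruences. -/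
theorem Centralizes.cols [L.IsAlgebraic] {E : Set (L.Term ℕ × L.Term ℕ)}
    (hE : IsCongruenceModular.{u, v, w} E) (hA : InVariety E A) {α β δ γ : Congruence L A}
    (h : Centralizes α β δ) (hδγ : δ ≤ γ) {x y p q : A} (hm : square α β x y p q)
    (hxp : γ x p) : γ y q :=
  (isSquareRelation_square α β).transpose.rel_of_rel hE hA
    (fun x y p q => centralizes_iff.1 h x p y q) hδγ hm hxp

theorem commutator_map_ge [L.IsAlgebraic] {E : Set (L.Term ℕ × L.Term ℕ)}
    (hE : IsCongruenceModular.{u, v, w} E) (hA : InVariety E A) (hB : InVariety E B)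
    {f : L.Hom A B} (hf : Function.Surjective f) (α β : Congruence L A) :
    commutator (α.map f) (β.map f) ≤ (commutator α β).map f := by
  refine fun a b hab => hab _ (centralizes_iff.2 fun x y p q hm hxy => ?_)
  have hcols : ∀ x y p q, imageSquare f α β x y p q →
      (commutator α β).map f x p → (commutator α β).map f y q := by
    rintro _ _ _ _ ⟨x, y, p, q, h, rfl, rfl, rfl, rfl⟩ hxp
    -- The preimage of f([α, β]) contains [α, β], so the column condition holds modulo it.
    exact (centralizes_commutator α β).cols hE hA
      (γ := comap f ((commutator α β).map f)) (fun _ _ k => map_apply f k) h hxp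
  have key : ∀ c d : B × B, ReflTransGen
      (fun c d : B × B => IsSquareRelation.horizontal (imageSquare f α β) c.1 c.2 d.1 d.2) c d →
      (commutator α β).map f c.1 c.2 → (commutator α β).map f d.1 d.2 := by
    intro c d hcd hc
    induction hcd with
    | refl => exact hc
    | tail _ h ih =>
      exact (isSquareRelation_imageSquare f α β).rel_of_chain hE hB hcols le_rfl h.2 ih
  exact key _ _ (grid_of_square_map hf hm).2 hxy

/-! ### The algebra α ≤ A² and maximality -/

section Pairs

/-- The congruence `α`, regarded as a subalgebra of `A × A`. -/
def Pairs (α : Congruence L A) : Type w := {p : A × A // α p.1 p.2}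

variable [L.IsAlgebraic] {α : Congruence L A}

instance : L.Structure (Pairs α) where
  funMap f x := ⟨(funMap f fun i => (x i).1.1, funMap f fun i => (x i).1.2),
    α.compat f fun i => (x i).2⟩
  RelMap r _ := isEmptyElim r

namespace Pairs

/-- The first projection. -/
def fst : L.Hom (Pairs α) A where
  toFun p := p.1.1
  map_fun' _ _ := rfl
  map_rel' r _ := isEmptyElim r

/-- The second projection. -/
def snd : L.Hom (Pairs α) A where
  toFun p := p.1.2
  map_fun' _ _ := rfl
  map_rel' r _ := isEmptyElim r

theorem snd_surjective : Function.Surjective (snd : L.Hom (Pairs α) A) :=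
  fun a => ⟨⟨(a, a), α.refl a⟩, rfl⟩

theorem inVariety {E : Set (L.Term ℕ × L.Term ℕ)} (hA : InVariety E A) :
    InVariety E (Pairs α) :=
  hA.of_jointly_injective (fun b : Bool => cond b fst snd) fun _ _ h =>
    Subtype.ext (Prod.ext (h true) (h false))

/-- The kernel of the first projection. -/
def fstKernel (α : Congruence L A) : Congruence L (Pairs α) where
  r p q := p.1.1 = q.1.1
  iseqv := ⟨fun _ => rfl, Eq.symm, Eq.trans⟩
  compat' f _ _ h := congrArg (funMap f) (funext h)

/-- The congruence `Δ`: the transitive closure of `M(α, β)` as a relation between columns. -/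
def delta (α β : Congruence L A) : Congruence L (Pairs α) :=
  ofChains (fun p q => square α β p.1.1 q.1.1 p.1.2 q.1.2)
    (fun _ _ h => (isSquareRelation_square α β).swap_cols h)
    (fun f g _ _ _ h => square_compat f
      (rel_update (R := fun p q : Pairs α => square α β p.1.1 q.1.1 p.1.2 q.1.2)
        (fun k => square_left (g k).2) h))

theorem map_snd_fstKernel : (fstKernel α).map snd = α := by
  refine le_antisymm (map_le_iff.2 fun p q hpq => ?_) fun a b hab => ?_
  · have hp : α p.1.1 p.1.2 := p.2
    have hq : α q.1.1 q.1.2 := q.2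
    have e : p.1.1 = q.1.1 := hpq
    exact α.trans (α.symm hp) (e ▸ hq)
  · have h : fstKernel α ⟨(a, a), α.refl a⟩ ⟨(a, b), hab⟩ := rfl
    exact map_apply snd h

theorem map_snd_delta {β : Congruence L A} : (delta α β).map snd = β := by
  refine le_antisymm (map_le_iff.2 fun p q hpq => ?_) fun a b hab => ?_
  · have h : ReflTransGen _ p q := hpq
    clear hpq
    induction h with
    | refl => exact β.refl _
    | tail _ h ih => exact β.trans ih (square_rel h).2.2
  · have h : delta α β ⟨(a, a), α.refl a⟩ ⟨(b, b), α.refl b⟩ :=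
      ReflTransGen.single (square_right hab)
    exact map_apply snd h

/-- A Δ-chain is a horizontal pasting of matrices; equal first coordinates give it a constant top
row. -/
theorem map_snd_inf_le {E : Set (L.Term ℕ × L.Term ℕ)}
    (hE : IsCongruenceModular.{u, v, w} E) (hA : InVariety E A) {β δ : Congruence L A}
    (hδ : Centralizes α β δ) : (fstKernel α ⊓ delta α β).map snd ≤ δ := by
  refine map_le_iff.2 fun p q hpq => ?_
  have e : p.1.1 = q.1.1 := hpq.1
  have h : ReflTransGen _ p q := hpq.2
  refine (isSquareRelation_square α β).rel_of_chain hE hA (x := p.1.1) (y := q.1.1)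
    (fun _ _ _ _ hm => hδ.cols hE hA le_rfl hm) le_rfl
    (ReflTransGen.lift (fun p : Pairs α => p.1) (fun _ _ hab => hab) _ _ h) ?_
  rw [e]

end Pairs

end Pairs

end Congruence

open Congruence in
/-- Every operation with the Hagemann–Herrmann properties lies below the commutator. -/
theorem IsHagemannHerrmann.le_commutator [L.IsAlgebraic] {E : Set (L.Term ℕ × L.Term ℕ)}
    (hE : IsCongruenceModular.{u, v, w} E) {C : CongruenceOperation.{u, v, w} E}
    (hC : IsHagemannHerrmann C) (hA : InVariety E A) (α β : Congruence L A) :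
    C A hA α β ≤ commutator α β := by
  intro a b hab δ hδ
  have h := hC.map_eq _ _ (Pairs.inVariety (α := α) hA) hA Pairs.snd Pairs.snd_surjective
    (Pairs.fstKernel α) (Pairs.delta α β)
  rw [Pairs.map_snd_fstKernel, Pairs.map_snd_delta] at h
  rw [← h] at hab
  have hle : (C _ (Pairs.inVariety hA) (Pairs.fstKernel α) (Pairs.delta α β)).map Pairs.snd ≤
      (Pairs.fstKernel α ⊓ Pairs.delta α β).map Pairs.snd :=
    map_le_iff.2 fun p q hpq => map_apply Pairs.snd (hC.le_inf _ _ _ _ hpq)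
  exact Pairs.map_snd_inf_le hE hA hδ (hle hab)

end UniversalAlgebra

theorem mainTheorem7 {L : FirstOrder.Language.{u, v}} [L.IsAlgebraic]
    (E : Set (L.Term ℕ × L.Term ℕ))
    (hE : UniversalAlgebra.IsCongruenceModular.{u, v, w} E) :
    UniversalAlgebra.IsHagemannHerrmann.{u, v, w} (UniversalAlgebra.commutatorOperation E) ∧
      ∀ C : UniversalAlgebra.CongruenceOperation.{u, v, w} E,
        UniversalAlgebra.IsHagemannHerrmann C →
          ∀ (A : Type w) [L.Structure A] (hA : UniversalAlgebra.InVariety E A)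
            (α β : UniversalAlgebra.Congruence L A),
            C A hA α β ≤ UniversalAlgebra.commutatorOperation E A hA α β := by
  refine ⟨⟨?_, ?_⟩, ?_⟩
  · intro A _ hA α β
    exact α.commutator_le_inf β
  · intro A B _ _ hA hB f hf α β
    exact le_antisymm (UniversalAlgebra.Congruence.commutator_map_le f α β)
      (UniversalAlgebra.Congruence.commutator_map_ge hE hA hB hf α β)
  · intro C hC A _ hA α β
    exact hC.le_commutator hE hA α β
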